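/- Let $N,d\ge 0$ be integers. For $i=1,\dots,N$ let $M_i\in\mathbb{R}^{d\times d}$ be a symmetric positive definite matrix and $V_i:\mathbb{R}^d\to\mathbb{R}$ a function, let $W:(\mathbb{R}^d)^N\to\mathbb{R}$, and for a horizon $t>0$ let $\Phi_t:(\mathbb{R}^d)^N\to\mathbb{R}$ be a terminal cost. Suppose that the functions $V_i$, $W$ and $\Phi_t$ are continuous and bounded from below, and that the total potential is coercive at infinity, i.e. $\sum_{i=1}^N V_i(x_i)+W(x)\to+\infty$ as $|x|\to\infty$. For $\xi=(\xi_1,\dots,\xi_N)\in W^{1,\infty}([0,t];(\mathbb{R}^d)^N)$, identified with its continuous representative and with weak derivative $\dot\xi$, put $$\mathcal J_t(\xi):=\int_0^t\Big(\sum_{i=1}^N\big(V_i(\xi_i(s))+\tfrac12\,\dot\xi_i(s)^\top M_i\,\dot\xi_i(s)\big)+W(\xi(s))\Big)\,ds+\Phi_t(\xi(t)).$$ Then, for every $x\in(\mathbb{R}^d)^N$ and every $t>0$, the functional $\mathcal J_t$ admits a minimizer in $\{\xi\in W^{1,\infty}([0,t];(\mathbb{R}^d)^N)\mid \xi(0)=x\}$.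 -/

import Mathlib

open MeasureTheory Set Filter Topology
open scoped ContDiff

namespace NBody

noncomputable section

section Sobolev

variable {E : Type*} [NormedAddCommGroup E] [NormedSpace ℝ E]

/-- `g` is a weak (distributional) derivative of `ξ` on the open interval `(0, t)`:
`∫₀ᵗ φ' ξ = - ∫₀ᵗ φ g` for every smooth `φ` with compact support in `(0, t)`. -/
def IsWeakDeriv (t : ℝ) (ξ g : ℝ → E) : Prop :=
  ∀ φ : ℝ → ℝ, ContDiff ℝ ∞ φ → HasCompactSupport φ → tsupport φ ⊆ Ioo 0 t →
    ∫ s in Ioo 0 t, deriv φ s • ξ s = - ∫ s in Ioo 0 t, φ s • g s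

/-- `g ∈ L^∞((0, t); E)` and `g` is a weak derivative of `ξ` on `(0, t)`. -/
def IsBoundedWeakDeriv (t : ℝ) (ξ g : ℝ → E) : Prop :=
  MemLp g ⊤ (volume.restrict (Ioo 0 t)) ∧ IsWeakDeriv t ξ g

/-- `ξ` is (the continuous representative of) an element of `W^{1,∞}([0, t]; E)`. Only the values
of `ξ` on `[0, t]` matter. -/
def MemW1Inf (t : ℝ) (ξ : ℝ → E) : Prop :=
  ContinuousOn ξ (Icc 0 t) ∧ MemLp ξ ⊤ (volume.restrict (Ioo 0 t)) ∧
    ∃ g : ℝ → E, IsBoundedWeakDeriv t ξ g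

open Classical in
/-- The weak derivative of `ξ ∈ W^{1,∞}([0, t]; E)`; it is determined up to equality almost
everywhere on `(0, t)`, see `weakDeriv_ae_eq`. -/
def weakDeriv (t : ℝ) (ξ : ℝ → E) : ℝ → E :=
  if h : ∃ g : ℝ → E, IsBoundedWeakDeriv t ξ g then h.choose else 0

theorem weakDeriv_spec {t : ℝ} {ξ : ℝ → E} (h : MemW1Inf t ξ) :
    IsBoundedWeakDeriv t ξ (weakDeriv t ξ) := by
  unfold weakDeriv
  rw [dif_pos h.2.2]
  exact h.2.2.choose_spec

theorem IsBoundedWeakDeriv.ae_eq [CompleteSpace E] {t : ℝ} {ξ g₁ g₂ : ℝ → E}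
    (h₁ : IsBoundedWeakDeriv t ξ g₁) (h₂ : IsBoundedWeakDeriv t ξ g₂) :
    g₁ =ᵐ[volume.restrict (Ioo 0 t)] g₂ := by
  have i₁ : IntegrableOn g₁ (Ioo 0 t) := h₁.1.integrable le_top
  have i₂ : IntegrableOn g₂ (Ioo 0 t) := h₂.1.integrable le_top
  have key : ∀ᵐ s, s ∈ Ioo 0 t → (g₁ - g₂) s = 0 := by
    refine isOpen_Ioo.ae_eq_zero_of_integral_contDiff_smul_eq_zero
      (i₁.sub i₂).locallyIntegrableOn ?_
    intro φ hφ hc hs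
    obtain ⟨C, hC⟩ := hc.exists_bound_of_continuous hφ.continuous
    have hm : AEStronglyMeasurable φ (volume.restrict (Ioo 0 t)) :=
      hφ.continuous.aestronglyMeasurable
    have j₁ : Integrable (fun s => φ s • g₁ s) (volume.restrict (Ioo 0 t)) :=
      i₁.bdd_smul C hm (Eventually.of_forall hC)
    have j₂ : Integrable (fun s => φ s • g₂ s) (volume.restrict (Ioo 0 t)) :=
      i₂.bdd_smul C hm (Eventually.of_forall hC)
    have e : ∫ s in Ioo 0 t, φ s • g₁ s = ∫ s in Ioo 0 t, φ s • g₂ s :=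
      neg_injective ((h₁.2 φ hφ hc hs).symm.trans (h₂.2 φ hφ hc hs))
    have hz : ∫ s in Ioo 0 t, φ s • (g₁ - g₂) s = 0 := by
      simp only [Pi.sub_apply, smul_sub]
      rw [integral_sub j₁ j₂, e, sub_self]
    rw [← hz]
    refine (setIntegral_eq_integral_of_forall_compl_eq_zero fun s hs' => ?_).symm
    rw [image_eq_zero_of_notMem_tsupport fun hh => hs' (hs hh), zero_smul]
  rw [EventuallyEq, ae_restrict_iff' measurableSet_Ioo]
  filter_upwards [key] with s hs hmem
  exact sub_eq_zero.mp (hs hmem)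

theorem weakDeriv_ae_eq [CompleteSpace E] {t : ℝ} {ξ g : ℝ → E} (hξ : MemW1Inf t ξ)
    (hg : IsBoundedWeakDeriv t ξ g) :
    weakDeriv t ξ =ᵐ[volume.restrict (Ioo 0 t)] g :=
  (weakDeriv_spec hξ).ae_eq hg

end Sobolev

/-- The joint state space `(ℝ^d)^N`. -/
abbrev Config (N d : ℕ) : Type := Fin N → EuclideanSpace ℝ (Fin d)

/-- The kinetic term `T(v) = ½ vᵀ M v`. -/
def kinetic {d : ℕ} (M : Matrix (Fin d) (Fin d) ℝ) (v : EuclideanSpace ℝ (Fin d)) : ℝ :=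
  (1 / 2 : ℝ) * (v.ofLp ⬝ᵥ M.mulVec v.ofLp)

/-- The total potential `∑ᵢ Vᵢ(xᵢ) + W(x)`. -/
def totalPotential {N d : ℕ} (V : Fin N → EuclideanSpace ℝ (Fin d) → ℝ) (W : Config N d → ℝ)
    (x : Config N d) : ℝ :=
  ∑ i, V i (x i) + W x

/-- The Bolza action functional
`J_t(ξ) = ∫₀ᵗ (∑ᵢ (Vᵢ(ξᵢ) + Tᵢ(ξᵢ')) + W(ξ)) ds + Φ(ξ(t))`. -/
def action {N d : ℕ} (M : Fin N → Matrix (Fin d) (Fin d) ℝ)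
    (V : Fin N → EuclideanSpace ℝ (Fin d) → ℝ) (W Φ : Config N d → ℝ) (t : ℝ)
    (ξ : ℝ → Config N d) : ℝ :=
  (∫ s in (0 : ℝ)..t,
      (∑ i, (V i (ξ s i) + kinetic (M i) (weakDeriv t ξ s i)) + W (ξ s))) + Φ (ξ t)

/-- The admissible paths: `ξ ∈ W^{1,∞}([0, t]; (ℝ^d)^N)` with `ξ(0) = x`. -/
def admissiblePaths {N d : ℕ} (t : ℝ) (x : Config N d) : Set (ℝ → Config N d) :=
  {ξ | MemW1Inf t ξ ∧ ξ 0 = x}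

end

end NBody

/-! Write the Lagrangian as `U(x) + T(v)`, where `T` is a convex quadratic form with `T v ≥ c‖v‖²`.
A path of class `W^{1,∞}` agrees on `[0, t]` with a Lipschitz path defined on all of `ℝ`, and its
weak derivative is the almost everywhere derivative (`MemW1Inf.exists_lipschitzWith`), so it
suffices to minimize over Lipschitz paths.

For a fixed Lipschitz constant this is the direct method: Arzelà–Ascoli gives compactness, and
Jensen's inequality for difference quotients gives lower semicontinuity
(`exists_isMinOn_bolza_lipschitzWith`).

The main point is a Lipschitz constant that suffices for all competitors
(`exists_lipschitz_bound_of_bolza`). A path no worse than the constant one has bounded kinetic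
energy, hence stays in a fixed ball. Slow it down wherever `√T` exceeds a level `K`, and recover the
lost time by speeding it up where it is slow. For large `K` the kinetic saving outweighs the extra
potential and kinetic cost (`exists_capped_path`), and the new speed is bounded in terms of `K` and
`c`. -/

namespace NBody

open scoped NNReal

/-! ### Lipschitz paths: fundamental theorem of calculus and weak derivatives. -/

section LipschitzCalculus

variable {E : Type*} [NormedAddCommGroup E] [NormedSpace ℝ E]

theorem lipschitzWith_primitive {g : ℝ → E} {C : ℝ≥0} (hg : LocallyIntegrable g volume)
    (hC : ∀ᵐ s, ‖g s‖ ≤ C) (a : ℝ) : LipschitzWith C fun x => ∫ s in a..x, g s := by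
  have hi (x y : ℝ) : IntervalIntegrable g volume x y :=
    intervalIntegrable_iff.mpr <|
      (hg.integrableOn_isCompact isCompact_uIcc).mono_set uIoc_subset_uIcc
  refine LipschitzWith.of_dist_le_mul fun x y => ?_
  rw [dist_eq_norm, intervalIntegral.integral_interval_sub_left (hi _ _) (hi _ _), Real.dist_eq]
  refine intervalIntegral.norm_integral_le_of_norm_le_const_ae ?_
  filter_upwards [hC] with s hs _ using hs

/-- The fundamental theorem of calculus for absolutely continuous vector-valued functions with
bounded derivative. -/
theorem integral_eq_sub_of_ae_hasDerivAt [CompleteSpace E] {f f' : ℝ → E} {a b : ℝ} {C : ℝ≥0}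
    (hab : a ≤ b)
    (hf : AbsolutelyContinuousOnInterval f a b)
    (hd : ∀ᵐ x, x ∈ Icc a b → HasDerivAt f (f' x) x)
    (hm : IntegrableOn f' (Icc a b)) (hC : ∀ x ∈ Icc a b, ‖f' x‖ ≤ C) :
    ∫ x in a..b, f' x = f b - f a := by
  -- After truncation the bound holds on all of `ℝ`, so the primitive of `g` is Lipschitz. Then `f`
  -- minus this primitive is absolutely continuous with derivative zero almost everywhere, hence
  -- constant.
  set g : ℝ → E := (Icc a b).indicator f' with hg
  have hgi : Integrable g := hm.integrable_indicator measurableSet_Icc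
  have hgC : ∀ᵐ s, ‖g s‖ ≤ C := Eventually.of_forall fun s => by
    by_cases hs : s ∈ Icc a b
    · simpa [hg, hs] using hC s hs
    · simp [hg, hs]
  have hL : LipschitzWith C fun x => ∫ s in a..x, g s :=
    lipschitzWith_primitive hgi.locallyIntegrable hgC a
  have hac : AbsolutelyContinuousOnInterval (fun x => f x - ∫ s in a..x, g s) a b :=
    hf.sub (hL.lipschitzOnWith).absolutelyContinuousOnInterval
  obtain ⟨c, hc⟩ := hac.const_of_ae_hasDerivAt_zero (by
    filter_upwards [hd, LocallyIntegrable.ae_hasDerivAt_integral hgi.locallyIntegrable] with x h1 h2 hx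
    rw [uIcc_of_le hab] at hx
    have := (h1 hx).sub (h2 a)
    simpa [hg, hx] using! this)
  have ha := hc a left_mem_uIcc
  have hb := hc b right_mem_uIcc
  have he : ∫ s in a..b, g s = ∫ s in a..b, f' s :=
    intervalIntegral.integral_congr fun s hs => by
      rw [uIcc_of_le hab] at hs
      simp [hg, hs]
  simp only [intervalIntegral.integral_same, sub_zero] at ha
  rw [← he, ha, ← hb]
  abel

variable [FiniteDimensional ℝ E]

theorem integrableOn_deriv_of_lipschitzWith {f : ℝ → E} {C : ℝ≥0} (hf : LipschitzWith C f)
    {s : Set ℝ} (hs : volume s ≠ ⊤) : IntegrableOn (deriv f) s := by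
  have := FiniteDimensional.complete ℝ E
  borelize E
  exact Measure.integrableOn_of_bounded hs (stronglyMeasurable_deriv f).aestronglyMeasurable
    (Eventually.of_forall fun _ => norm_deriv_le_of_lipschitz hf)

theorem integral_deriv_of_lipschitzWith {f : ℝ → E} {C : ℝ≥0} (hf : LipschitzWith C f)
    {a b : ℝ} (hab : a ≤ b) : ∫ x in a..b, deriv f x = f b - f a := by
  have := FiniteDimensional.complete ℝ E
  refine integral_eq_sub_of_ae_hasDerivAt (C := C) hab
    hf.lipschitzOnWith.absolutelyContinuousOnInterval ?_
    (integrableOn_deriv_of_lipschitzWith hf (by simp))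
    fun _ _ => norm_deriv_le_of_lipschitz hf
  filter_upwards [hf.ae_differentiableAt_real] with x hx _ using hx.hasDerivAt

/-- Integrate the product rule for `φ • f` over `[0, t]`; the boundary terms vanish because the
support of `φ` avoids `0` and `t`. -/
theorem isBoundedWeakDeriv_of_lipschitzWith {f : ℝ → E} {C : ℝ≥0} (hf : LipschitzWith C f)
    {t : ℝ} (ht : 0 ≤ t) : IsBoundedWeakDeriv t f (deriv f) := by
  have := FiniteDimensional.complete ℝ E
  have hb (x : ℝ) : ‖deriv f x‖ ≤ C := norm_deriv_le_of_lipschitz hf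
  have hm : StronglyMeasurable (deriv f) := by
    borelize E
    exact stronglyMeasurable_deriv f
  refine ⟨memLp_top_of_bound hm.aestronglyMeasurable C (Eventually.of_forall hb), ?_⟩
  intro φ hφ hc hs
  have h1 : ContDiff ℝ 1 φ := hφ.of_le (by exact_mod_cast le_top)
  have hdc : Continuous (deriv φ) := h1.continuous_deriv le_rfl
  have i1 : IntegrableOn (fun s => deriv φ s • f s) (Icc 0 t) :=
    (hdc.smul hf.continuous).integrableOn_Icc
  have i2 : IntegrableOn (fun s => φ s • deriv f s) (Icc 0 t) :=
    (integrableOn_deriv_of_lipschitzWith hf (by simp)).continuousOn_smul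
      hφ.continuous.continuousOn isCompact_Icc
  obtain ⟨B, hB⟩ := isCompact_Icc.exists_bound_of_continuousOn (s := Icc 0 t)
    (hdc.smul hf.continuous).continuousOn
  obtain ⟨D, hD⟩ := isCompact_Icc.exists_bound_of_continuousOn (s := Icc 0 t)
    hφ.continuous.continuousOn
  have key : ∫ s in (0 : ℝ)..t, (φ s • deriv f s + deriv φ s • f s) = φ t • f t - φ 0 • f 0 := by
    refine integral_eq_sub_of_ae_hasDerivAt (f := fun s => φ s • f s)
      (C := Real.toNNReal (D * C + B)) ht
      (h1.contDiffOn.absolutelyContinuousOnInterval.smul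
        hf.lipschitzOnWith.absolutelyContinuousOnInterval) ?_ (i2.add i1) ?_
    · filter_upwards [hf.ae_differentiableAt_real] with x hx _
      exact ((h1.differentiable one_ne_zero) x).hasDerivAt.smul hx.hasDerivAt
    · intro x hx
      refine le_trans ?_ (Real.le_coe_toNNReal _)
      refine (norm_add_le _ _).trans (add_le_add ?_ (hB x hx))
      rw [norm_smul]
      exact mul_le_mul (hD x hx) (hb x) (norm_nonneg _) ((norm_nonneg _).trans (hD x hx))
  have z0 : φ 0 = 0 := image_eq_zero_of_notMem_tsupport fun h => by simpa using hs h
  have zt : φ t = 0 := image_eq_zero_of_notMem_tsupport fun h => by simpa using hs h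
  rw [z0, zt, intervalIntegral.integral_of_le ht, integral_Ioc_eq_integral_Ioo,
    integral_add (i2.mono_set Ioo_subset_Icc_self) (i1.mono_set Ioo_subset_Icc_self)] at key
  simp only [zero_smul, sub_zero] at key
  exact eq_neg_of_add_eq_zero_right key

theorem memW1Inf_of_lipschitzWith {f : ℝ → E} {C : ℝ≥0} (hf : LipschitzWith C f)
    {t : ℝ} (ht : 0 ≤ t) : MemW1Inf t f := by
  obtain ⟨B, hB⟩ := isCompact_Icc.exists_bound_of_continuousOn (s := Icc 0 t)
    hf.continuous.continuousOn
  refine ⟨hf.continuous.continuousOn, memLp_top_of_bound hf.continuous.aestronglyMeasurable B ?_,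
    _, isBoundedWeakDeriv_of_lipschitzWith hf ht⟩
  filter_upwards [ae_restrict_mem measurableSet_Ioo] with s hs
  exact hB s (Ioo_subset_Icc_self hs)

end LipschitzCalculus

/-! ### The du Bois-Reymond lemma and Lipschitz representatives of `W^{1,∞}` paths. -/

section DuBoisReymond

variable {E : Type*} [NormedAddCommGroup E] [NormedSpace ℝ E]

theorem exists_Icc_of_isCompact_subset_Ioo {K : Set ℝ} {l u : ℝ} (hlu : l < u) (hK : IsCompact K)
    (hs : K ⊆ Ioo l u) : ∃ a b, l < a ∧ b < u ∧ K ⊆ Icc a b := by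
  rcases K.eq_empty_or_nonempty with rfl | hne
  · obtain ⟨m, h1, h2⟩ := exists_between hlu
    exact ⟨m, m, h1, h2, empty_subset _⟩
  · exact ⟨sInf K, sSup K, (hs (hK.sInf_mem hne)).1, (hs (hK.sSup_mem hne)).2, fun x hx =>
      ⟨csInf_le hK.bddBelow hx, le_csSup hK.bddAbove hx⟩⟩

/-- A test function on `(0, t)` with integral zero is the derivative of a test function. -/
theorem exists_primitive_test_function {t : ℝ} (ht : 0 < t) {χ : ℝ → ℝ} (hχ : ContDiff ℝ ∞ χ)
    (hc : HasCompactSupport χ) (hs : tsupport χ ⊆ Ioo 0 t) (hz : ∫ s in Ioo 0 t, χ s = 0) :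
    ∃ φ : ℝ → ℝ, ContDiff ℝ ∞ φ ∧ HasCompactSupport φ ∧ tsupport φ ⊆ Ioo 0 t ∧ deriv φ = χ := by
  obtain ⟨a, b, ha, hb, hab⟩ := exists_Icc_of_isCompact_subset_Ioo ht hc hs
  have hχ0 (s : ℝ) (h : s ∉ Icc a b) : χ s = 0 :=
    image_eq_zero_of_notMem_tsupport fun h' => h (hab h')
  have hd (x : ℝ) : HasDerivAt (fun x => ∫ s in (0 : ℝ)..x, χ s) (χ x) x :=
    intervalIntegral.integral_hasDerivAt_right (hχ.continuous.intervalIntegrable _ _)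
      (hχ.continuous.stronglyMeasurableAtFilter _ _) hχ.continuous.continuousAt
  have hde : deriv (fun x => ∫ s in (0 : ℝ)..x, χ s) = χ := funext fun x => (hd x).deriv
  -- The primitive from `0` vanishes left of `a` because `χ` does, and right of `b` because the
  -- total integral of `χ` is zero.
  have hsub : tsupport (fun x => ∫ s in (0 : ℝ)..x, χ s) ⊆ Icc a b := by
    refine closure_minimal (fun x hx => ?_) isClosed_Icc
    by_contra hx'
    apply hx
    rcases lt_or_ge x a with h | h
    · refine (intervalIntegral.integral_congr (g := fun _ => (0 : ℝ)) fun s hs => hχ0 s ?_).trans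
        (by simp)
      rintro ⟨h1, h2⟩
      have := hs.2
      rcases le_total 0 x with h3 | h3
      · rw [sup_of_le_right h3] at this; linarith
      · rw [sup_of_le_left h3] at this; linarith
    · have hbx : b < x := by
        by_contra h'
        exact hx' ⟨h, not_lt.mp h'⟩
      have e : ∫ s in t..x, χ s = 0 := by
        refine (intervalIntegral.integral_congr (g := fun _ => (0 : ℝ)) fun s hs => hχ0 s ?_).trans
          (by simp)
        rintro ⟨h1, h2⟩
        have := hs.1
        rcases le_total t x with h3 | h3
        · rw [inf_of_le_left h3] at this; linarith
        · rw [inf_of_le_right h3] at this; linarith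
      change ∫ s in (0 : ℝ)..x, χ s = 0
      rw [← intervalIntegral.integral_add_adjacent_intervals
        (hχ.continuous.intervalIntegrable 0 t) (hχ.continuous.intervalIntegrable t x), e,
        intervalIntegral.integral_of_le ht.le, integral_Ioc_eq_integral_Ioo, hz, add_zero]
  refine ⟨_, contDiff_infty_iff_deriv.mpr ⟨fun x => (hd x).differentiableAt, by rwa [hde]⟩,
    HasCompactSupport.of_support_subset_isCompact isCompact_Icc (subset_closure.trans hsub),
    hsub.trans fun x hx => ⟨ha.trans_le hx.1, hx.2.trans_lt hb⟩, hde⟩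

/-- The **du Bois-Reymond lemma** in first order form: a continuous function with zero weak
derivative is constant. -/
theorem exists_eq_const_of_isWeakDeriv_zero [CompleteSpace E] {t : ℝ} (ht : 0 < t) {η : ℝ → E}
    (hη : ContinuousOn η (Icc 0 t)) (hw : IsWeakDeriv t η 0) : ∃ c, EqOn η (fun _ => c) (Icc 0 t) := by
  let ρ : ContDiffBump (t / 2) := ⟨t / 8, t / 4, by positivity, by linarith⟩
  have hρd : ContDiff ℝ ∞ (ρ.normed volume) := ρ.contDiff_normed
  have hρs : tsupport (ρ.normed volume) ⊆ Ioo 0 t := by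
    rw [ρ.tsupport_normed_eq, Real.closedBall_eq_Icc]
    intro x hx
    have : ρ.rOut = t / 4 := rfl
    rw [this] at hx
    exact ⟨by linarith [hx.1], by linarith [hx.2]⟩
  have hρc : HasCompactSupport (ρ.normed volume) := ρ.hasCompactSupport_normed
  have hint {φ : ℝ → ℝ} (hs : tsupport φ ⊆ Ioo 0 t) : ∫ s in Ioo 0 t, φ s = ∫ s, φ s :=
    setIntegral_eq_integral_of_forall_compl_eq_zero fun s hs' =>
      image_eq_zero_of_notMem_tsupport fun hh => hs' (hs hh)
  have hρ1 : ∫ s in Ioo 0 t, ρ.normed volume s = 1 := (hint hρs).trans ρ.integral_normed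
  have hηi : IntegrableOn η (Ioo 0 t) := hη.integrableOn_Icc.mono_set Ioo_subset_Icc_self
  have hsm {φ : ℝ → ℝ} (hφ : Continuous φ) : IntegrableOn (fun s => φ s • η s) (Ioo 0 t) :=
    ((hφ.continuousOn.smul hη).integrableOn_Icc).mono_set Ioo_subset_Icc_self
  -- The constant must be the `ρ`-weighted mean of `η`. For a test function `ψ` with integral `k`,
  -- the difference `ψ - k ρ` has mean zero, so it is the derivative of a test function, and the
  -- hypothesis gives `∫ ψ η = k c`.
  set c : E := ∫ s in Ioo 0 t, ρ.normed volume s • η s with hcdef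
  refine ⟨c, ?_⟩
  have key : ∀ᵐ s, s ∈ Ioo 0 t → (η s - c) = 0 := by
    refine isOpen_Ioo.ae_eq_zero_of_integral_contDiff_smul_eq_zero (f := fun s => η s - c)
      (hηi.sub (integrableOn_const (by simp))).locallyIntegrableOn ?_
    intro ψ hψ hψc hψs
    have hψi : IntegrableOn ψ (Ioo 0 t) :=
      hψ.continuous.integrableOn_Icc.mono_set Ioo_subset_Icc_self
    have hρi : IntegrableOn (ρ.normed volume) (Ioo 0 t) :=
      hρd.continuous.integrableOn_Icc.mono_set Ioo_subset_Icc_self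
    set k : ℝ := ∫ s in Ioo 0 t, ψ s with hk
    have hts : tsupport (fun s => ψ s - k * ρ.normed volume s) ⊆
        tsupport ψ ∪ tsupport (ρ.normed volume) := by
      refine closure_minimal (fun x hx => ?_) ((isClosed_tsupport _).union (isClosed_tsupport _))
      by_contra h
      rw [mem_union, not_or] at h
      exact hx (by simp [image_eq_zero_of_notMem_tsupport h.1,
        image_eq_zero_of_notMem_tsupport h.2])
    obtain ⟨φ, hφ, hφc, hφs, hφd⟩ := exists_primitive_test_function ht
      (χ := fun s => ψ s - k * ρ.normed volume s) (hψ.sub (contDiff_const.mul hρd))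
      (HasCompactSupport.of_support_subset_isCompact (hψc.isCompact.union hρc.isCompact)
        (subset_closure.trans hts))
      (hts.trans (union_subset hψs hρs))
      (by rw [integral_sub hψi (hρi.const_mul k), integral_const_mul, hρ1, mul_one, sub_self])
    have h0 := hw φ hφ hφc hφs
    rw [hφd] at h0
    simp only [Pi.zero_apply, smul_zero, integral_zero, neg_zero, sub_smul, mul_smul] at h0
    rw [integral_sub (hsm hψ.continuous) (g := fun s => k • ρ.normed volume s • η s)
      ((hsm hρd.continuous).smul k), integral_smul, ← hcdef,
      sub_eq_zero] at h0
    have : ∫ s in Ioo 0 t, ψ s • (η s - c) = 0 := by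
      simp only [smul_sub]
      rw [integral_sub (hsm hψ.continuous) (hψi.smul_const c), h0, integral_smul_const, ← hk,
        sub_self]
    rw [← this]
    refine (setIntegral_eq_integral_of_forall_compl_eq_zero fun s hs' => ?_).symm
    rw [image_eq_zero_of_notMem_tsupport fun hh => hs' (hψs hh), zero_smul]
  refine Measure.eqOn_Icc_of_ae_eq volume ht.ne ?_ hη continuousOn_const
  rw [restrict_Ioo_eq_restrict_Icc.symm, EventuallyEq, ae_restrict_iff' measurableSet_Ioo]
  filter_upwards [key] with s hs hmem using sub_eq_zero.mp (hs hmem)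

/-- Every path of class `W^{1,∞}` is Lipschitz, and its weak derivative is its almost everywhere
derivative. -/
theorem MemW1Inf.exists_lipschitzWith [FiniteDimensional ℝ E] {t : ℝ} (ht : 0 < t) {ξ : ℝ → E}
    (hξ : MemW1Inf t ξ) : ∃ (C : ℝ≥0) (f : ℝ → E), LipschitzWith C f ∧ EqOn ξ f (Icc 0 t) ∧
      weakDeriv t ξ =ᵐ[volume.restrict (Ioo 0 t)] deriv f := by
  have := FiniteDimensional.complete ℝ E
  have hg := weakDeriv_spec hξ
  set g := weakDeriv t ξ with hgdef
  -- Extended by zero, the weak derivative has a primitive `G` that is Lipschitz on all of `ℝ`.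
  -- Since `ξ - G` has zero weak derivative, it is constant on `[0, t]`.
  have hgi : Integrable ((Ioo 0 t).indicator g) :=
    (IntegrableOn.integrable_indicator (hg.1.integrable le_top) measurableSet_Ioo)
  obtain ⟨C, hC⟩ : ∃ C : ℝ≥0, ∀ᵐ s, ‖(Ioo 0 t).indicator g s‖ ≤ C := by
    refine ⟨(eLpNorm g ⊤ (volume.restrict (Ioo 0 t))).toNNReal, ?_⟩
    have h := ae_le_eLpNormEssSup (f := g) (μ := volume.restrict (Ioo 0 t))
    rw [ae_restrict_iff' measurableSet_Ioo] at h
    filter_upwards [h] with s hs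
    by_cases hm : s ∈ Ioo 0 t
    · have h2 := hs hm
      rw [← eLpNorm_exponent_top, ← ENNReal.coe_toNNReal hg.1.2.ne] at h2
      rw [indicator_of_mem hm]
      exact_mod_cast h2
    · simp [hm]
  have hL := lipschitzWith_primitive hgi.locallyIntegrable hC 0
  set G : ℝ → E := fun x => ∫ s in (0 : ℝ)..x, (Ioo 0 t).indicator g s with hG
  have hder : g =ᵐ[volume.restrict (Ioo 0 t)] deriv G := by
    rw [EventuallyEq, ae_restrict_iff' measurableSet_Ioo]
    filter_upwards [LocallyIntegrable.ae_hasDerivAt_integral hgi.locallyIntegrable] with s hs hm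
    rw [(hs 0).deriv, indicator_of_mem hm]
  have hGw := (isBoundedWeakDeriv_of_lipschitzWith hL ht.le).2
  obtain ⟨c, hc⟩ := exists_eq_const_of_isWeakDeriv_zero ht (η := fun s => ξ s - G s)
    (hξ.1.sub hL.continuous.continuousOn) (by
      intro φ hφ hφc hφs
      have hdc : Continuous (deriv φ) :=
        (hφ.of_le (by exact_mod_cast le_top) : ContDiff ℝ 1 φ).continuous_deriv le_rfl
      have i1 : IntegrableOn (fun s => deriv φ s • ξ s) (Ioo 0 t) :=
        (hdc.continuousOn.smul hξ.1).integrableOn_Icc.mono_set Ioo_subset_Icc_self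
      have i2 : IntegrableOn (fun s => deriv φ s • G s) (Ioo 0 t) :=
        (hdc.smul hL.continuous).integrableOn_Icc.mono_set Ioo_subset_Icc_self
      simp only [smul_sub, Pi.zero_apply, smul_zero, integral_zero, neg_zero]
      rw [integral_sub i1 i2, hg.2 φ hφ hφc hφs, hGw φ hφ hφc hφs, sub_eq_zero]
      congr 1
      exact integral_congr_ae (hder.mono fun s hs => by simp only [hs]))
  refine ⟨C, fun s => G s + c, LipschitzWith.of_dist_le_mul fun x y => ?_, fun s hs => ?_, ?_⟩
  · rw [dist_add_right]
    exact hL.dist_le_mul x y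
  · have := hc hs
    simp only at this
    simp [← this]
  · have : deriv (fun s => G s + c) = deriv G := funext fun s => deriv_add_const c
    rw [this]
    exact hder

end DuBoisReymond

/-! ### Direct method at a fixed Lipschitz constant. -/

section LipschitzMinimizer

variable {E : Type*} [NormedAddCommGroup E] [NormedSpace ℝ E]

/-- The action `∫₀ᵗ (U(f) + T(f')) ds + Φ(f(t))` of a Lipschitz path, computed with its almost
everywhere derivative. -/
noncomputable def bolza (U T Φ : E → ℝ) (t : ℝ) (f : ℝ → E) : ℝ :=
  (∫ s in (0 : ℝ)..t, (U (f s) + T (deriv f s))) + Φ (f t)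

variable [FiniteDimensional ℝ E]

theorem exists_bound_comp_deriv {T : E → ℝ} (hT : Continuous T) (C : ℝ≥0) :
    ∃ B : ℝ, 0 ≤ B ∧ ∀ f : ℝ → E, LipschitzWith C f → ∀ s, |T (deriv f s)| ≤ B := by
  have := FiniteDimensional.proper ℝ E
  obtain ⟨B, hB⟩ := (isCompact_closedBall (0 : E) C).exists_bound_of_continuousOn hT.continuousOn
  refine ⟨B, (norm_nonneg _).trans (hB 0 (by simp)), fun f hf s => hB _ ?_⟩
  simpa using norm_deriv_le_of_lipschitz hf

theorem measurable_comp_deriv {T : E → ℝ} (hT : Continuous T) (f : ℝ → E) :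
    Measurable fun s => T (deriv f s) := by
  have := FiniteDimensional.complete ℝ E
  borelize E
  exact hT.measurable.comp (measurable_deriv f)

theorem integrableOn_comp_deriv {T : E → ℝ} (hT : Continuous T) {C : ℝ≥0} {f : ℝ → E}
    (hf : LipschitzWith C f) {s : Set ℝ} (hs : volume s ≠ ⊤) :
    IntegrableOn (fun s => T (deriv f s)) s := by
  obtain ⟨B, -, hB⟩ := exists_bound_comp_deriv hT C
  exact Measure.integrableOn_of_bounded hs (measurable_comp_deriv hT f).aestronglyMeasurable
    (Eventually.of_forall fun s => hB f hf s)

theorem intervalIntegrable_comp_deriv {T : E → ℝ} (hT : Continuous T) {C : ℝ≥0} {f : ℝ → E}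
    (hf : LipschitzWith C f) (a b : ℝ) :
    IntervalIntegrable (fun s => T (deriv f s)) volume a b :=
  ⟨integrableOn_comp_deriv hT hf (by simp), integrableOn_comp_deriv hT hf (by simp)⟩

theorem bolza_eq_add {U T Φ : E → ℝ} (hU : Continuous U) (hT : Continuous T) {C : ℝ≥0}
    {f : ℝ → E} (hf : LipschitzWith C f) (t : ℝ) :
    bolza U T Φ t f =
      (∫ s in (0 : ℝ)..t, U (f s)) + (∫ s in (0 : ℝ)..t, T (deriv f s)) + Φ (f t) := by
  rw [bolza, intervalIntegral.integral_add
    (Continuous.intervalIntegrable (u := fun s => U (f s)) (hU.comp hf.continuous) _ _)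
    (intervalIntegrable_comp_deriv hT hf _ _)]

/-- Jensen's inequality for difference quotients of Lipschitz paths. -/
theorem comp_slope_le_integral {T : E → ℝ} (hT : Continuous T) (hTc : ConvexOn ℝ univ T)
    {C : ℝ≥0} {f : ℝ → E} (hf : LipschitzWith C f) {h : ℝ} (hh : 0 < h) (s : ℝ) :
    T (h⁻¹ • (f (s + h) - f s)) ≤ h⁻¹ * ∫ r in s..s + h, T (deriv f r) := by
  have := FiniteDimensional.complete ℝ E
  have hs : s ≤ s + h := by linarith
  have key := hTc.map_set_average_le (μ := volume) (t := Ioc s (s + h)) (f := deriv f)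
    hT.continuousOn isClosed_univ (by simp [hh]) (by simp) (by simp)
    (integrableOn_deriv_of_lipschitzWith hf (by simp))
    (integrableOn_comp_deriv hT hf (by simp))
  rwa [setAverage_eq, setAverage_eq, ← intervalIntegral.integral_of_le hs,
    ← intervalIntegral.integral_of_le hs, integral_deriv_of_lipschitzWith hf hs,
    Real.volume_real_Ioc_of_le hs, add_sub_cancel_left, smul_eq_mul] at key

/-- Integrate Jensen's inequality in `s`. With `F` the primitive of `T(f')`, the integral of `F(s +
h) - F(s)` telescopes to `∫_t^{t+h} F - ∫_0^h F ≤ h F(t + h)`. The error `h * B` pays for the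
averaging window overrunning `t` by at most `h`. -/
theorem integral_comp_slope_le {T : E → ℝ} (hT : Continuous T) (hTc : ConvexOn ℝ univ T)
    (hT0 : ∀ v, 0 ≤ T v) {C : ℝ≥0} {B : ℝ} {f : ℝ → E} (hf : LipschitzWith C f)
    (hB : ∀ s, T (deriv f s) ≤ B) {t h : ℝ} (ht : 0 ≤ t) (hh : 0 < h) :
    ∫ s in (0 : ℝ)..t, T (h⁻¹ • (f (s + h) - f s)) ≤
      (∫ s in (0 : ℝ)..t, T (deriv f s)) + h * B := by
  have hi := intervalIntegrable_comp_deriv hT hf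
  set F : ℝ → ℝ := fun s => ∫ r in (0 : ℝ)..s, T (deriv f r) with hF
  have hFc : Continuous F := intervalIntegral.continuous_primitive hi 0
  have hFi (a b : ℝ) : IntervalIntegrable F volume a b := hFc.intervalIntegrable a b
  have hFd (a b : ℝ) : F b - F a = ∫ r in a..b, T (deriv f r) :=
    intervalIntegral.integral_interval_sub_left (hi _ _) (hi _ _)
  have hFm : Monotone F := fun a b hab => by
    rw [← sub_nonneg, hFd]
    exact intervalIntegral.integral_nonneg hab fun _ _ => hT0 _
  have hF0 : F 0 = 0 := intervalIntegral.integral_same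
  have hFB : F (t + h) ≤ F t + h * B := by
    have : F (t + h) - F t ≤ ∫ r in t..t + h, B := by
      rw [hFd]
      exact intervalIntegral.integral_mono_on (by linarith) (hi _ _) (by simp) fun s _ => hB s
    simp only [intervalIntegral.integral_const, add_sub_cancel_left, smul_eq_mul] at this
    linarith
  have hcs : Continuous fun s => F (s + h) := hFc.comp (by fun_prop)
  have h1 : ∫ s in (0 : ℝ)..t, T (h⁻¹ • (f (s + h) - f s)) ≤
      ∫ s in (0 : ℝ)..t, h⁻¹ * (F (s + h) - F s) := by
    refine intervalIntegral.integral_mono_on ht ?_ ?_ fun s _ => ?_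
    · have := hf.continuous
      exact Continuous.intervalIntegrable (by fun_prop) _ _
    · exact Continuous.intervalIntegrable (by fun_prop) _ _
    · rw [hFd]
      exact comp_slope_le_integral hT hTc hf hh s
  have h2 : ∫ s in (0 : ℝ)..t, (F (s + h) - F s) = (∫ s in t..t + h, F s) - ∫ s in (0 : ℝ)..h, F s := by
    rw [intervalIntegral.integral_sub (hcs.intervalIntegrable _ _) (hFi _ _),
      intervalIntegral.integral_comp_add_right, zero_add,
      intervalIntegral.integral_interval_sub_interval_comm (hFi _ _) (hFi _ _) (hFi _ _)]
    rw [intervalIntegral.integral_symm t (t + h), intervalIntegral.integral_symm 0 h]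
    ring
  have h3 : ∫ s in t..t + h, F s ≤ ∫ s in t..t + h, F (t + h) :=
    intervalIntegral.integral_mono_on (by linarith) (hFi _ _) (by simp) fun s hs => hFm hs.2
  have h4 : 0 ≤ ∫ s in (0 : ℝ)..h, F s :=
    intervalIntegral.integral_nonneg hh.le fun s hs => hF0 ▸ hFm hs.1
  rw [intervalIntegral.integral_const, add_sub_cancel_left, smul_eq_mul] at h3
  rw [intervalIntegral.integral_const_mul, h2] at h1
  refine h1.trans (le_trans ?_ hFB)
  rw [inv_mul_le_iff₀ hh]
  linarith

/-- Dominated convergence: the difference quotients stay in the ball of radius `C` and converge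
almost everywhere by Rademacher's theorem. -/
theorem tendsto_integral_comp_slope {T : E → ℝ} (hT : Continuous T) {C : ℝ≥0} {f : ℝ → E}
    (hf : LipschitzWith C f) (t : ℝ) :
    Tendsto (fun h : ℝ => ∫ s in (0 : ℝ)..t, T (h⁻¹ • (f (s + h) - f s))) (𝓝[>] 0)
      (𝓝 (∫ s in (0 : ℝ)..t, T (deriv f s))) := by
  have := FiniteDimensional.proper ℝ E
  have hfc := hf.continuous
  obtain ⟨B, hB⟩ := (isCompact_closedBall (0 : E) C).exists_bound_of_continuousOn hT.continuousOn
  refine intervalIntegral.tendsto_integral_filter_of_dominated_convergence (fun _ => B) ?_ ?_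
    intervalIntegrable_const ?_
  · refine Eventually.of_forall fun h => Continuous.aestronglyMeasurable (by fun_prop)
  · filter_upwards [self_mem_nhdsWithin] with h hh
    refine Eventually.of_forall fun s _ => hB _ ?_
    have h0 : (0 : ℝ) < h := hh
    rw [mem_closedBall_zero_iff, norm_smul, norm_inv, Real.norm_of_nonneg h0.le,
      inv_mul_le_iff₀ h0, ← dist_eq_norm, mul_comm]
    refine (hf.dist_le_mul _ _).trans_eq ?_
    rw [Real.dist_eq, add_sub_cancel_left, abs_of_pos h0]
  · filter_upwards [hf.ae_differentiableAt_real] with s hs _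
    exact (hT.tendsto _).comp hs.hasDerivAt.tendsto_slope_zero_right

/-- Arzelà–Ascoli in the compact-open topology: the paths are equi-Lipschitz, and their values at
`s` lie in the compact ball of radius `C * |s|` about `x`. -/
theorem isCompact_setOf_lipschitzWith (C : ℝ≥0) (x : E) :
    IsCompact {f : C(ℝ, E) | LipschitzWith C f ∧ f 0 = x} := by
  have := FiniteDimensional.proper ℝ E
  refine ArzelaAscoli.isCompact_of_equicontinuous _ ?_ ?_
  · have he : ContinuousMap.toFun '' {f : C(ℝ, E) | LipschitzWith C f ∧ f 0 = x} =
        {f : ℝ → E | LipschitzWith C f} ∩ {f | f 0 = x} := by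
      ext f
      constructor
      · rintro ⟨g, hg, rfl⟩
        exact hg
      · rintro ⟨h1, h2⟩
        exact ⟨⟨f, h1.continuous⟩, ⟨h1, h2⟩, rfl⟩
    rw [he]
    refine (isCompact_univ_pi fun s : ℝ => isCompact_closedBall x (C * |s|)).of_isClosed_subset
      ((isClosed_setOfPred_lipschitzWith C).inter
        (isClosed_eq (continuous_apply 0) continuous_const)) ?_
    rintro f ⟨h1, h2⟩ s -
    have h3 : LipschitzWith C f := h1
    have h4 : f 0 = x := h2
    have := h3.dist_le_mul s 0
    rwa [h4, Real.dist_eq, sub_zero] at this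
  · exact (LipschitzWith.uniformEquicontinuous _ C fun f => f.2.1).equicontinuous

/-- The Bolza action attains its minimum among the paths with a given Lipschitz constant. -/
theorem exists_isMinOn_bolza_lipschitzWith {U T Φ : E → ℝ} (hU : Continuous U)
    (hT : Continuous T) (hTc : ConvexOn ℝ univ T) (hT0 : ∀ v, 0 ≤ T v) (hΦ : Continuous Φ)
    {t : ℝ} (ht : 0 ≤ t) (C : ℝ≥0) (x : E) :
    ∃ f : ℝ → E, (LipschitzWith C f ∧ f 0 = x) ∧
      IsMinOn (bolza U T Φ t) {f | LipschitzWith C f ∧ f 0 = x} f := by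
  obtain ⟨B, hB0, hB⟩ := exists_bound_comp_deriv hT C
  have hlsc : LowerSemicontinuousOn (fun f : C(ℝ, E) => bolza U T Φ t f)
      {f : C(ℝ, E) | LipschitzWith C f ∧ f 0 = x} := by
    intro f hf y hy
    -- Replacing the derivative by a difference quotient makes the functional continuous. Each `J h`
    -- with `h > 0` lies below the action on the constraint set and `J h f` tends to the action of
    -- `f`, which gives lower semicontinuity.
    set J : ℝ → C(ℝ, E) → ℝ := fun h g => (∫ s in (0 : ℝ)..t, U (g s)) +
      ((∫ s in (0 : ℝ)..t, T (h⁻¹ • (g (s + h) - g s))) - h * B) + Φ (g t) with hJ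
    have hJc (h : ℝ) : Continuous (J h) := by
      refine ((intervalIntegral.continuous_parametric_intervalIntegral_of_continuous' ?_ _ _).add
        ((intervalIntegral.continuous_parametric_intervalIntegral_of_continuous' ?_ _ _).sub
          continuous_const)).add (hΦ.comp (continuous_eval_const t))
      · exact hU.comp continuous_eval
      · refine hT.comp (continuous_const.smul (Continuous.sub ?_ continuous_eval))
        exact continuous_eval.comp
          (continuous_fst.prodMk (continuous_snd.add continuous_const))
    have hle {h : ℝ} (hh : 0 < h) {g : C(ℝ, E)} (hg : LipschitzWith C g) :
        J h g ≤ bolza U T Φ t g := by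
      rw [bolza_eq_add hU hT hg]
      have := integral_comp_slope_le hT hTc hT0 hg (fun s => (abs_le.mp (hB g hg s)).2) ht hh
      simp only [hJ]
      linarith
    have hlim : Tendsto (fun h => J h f) (𝓝[>] 0) (𝓝 (bolza U T Φ t f)) := by
      rw [bolza_eq_add hU hT hf.1]
      refine (tendsto_const_nhds.add ?_).add_const _
      have h0 : Tendsto (fun h : ℝ => h * B) (𝓝[>] 0) (𝓝 0) := by
        have : Tendsto (fun h : ℝ => h * B) (𝓝 0) (𝓝 (0 * B)) := tendsto_id.mul_const B
        rw [zero_mul] at this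
        exact this.mono_left nhdsWithin_le_nhds
      simpa using (tendsto_integral_comp_slope hT hf.1 t).sub h0
    obtain ⟨h, hyh, hh⟩ := ((hlim.eventually_const_lt hy).and self_mem_nhdsWithin).exists
    filter_upwards [((hJc h).continuousAt.continuousWithinAt).eventually_const_lt hyh,
      self_mem_nhdsWithin] with g hg hgS
    exact hg.trans_le (hle hh hgS.1)
  have hne : {f : C(ℝ, E) | LipschitzWith C f ∧ f 0 = x}.Nonempty :=
    ⟨ContinuousMap.const ℝ x, (LipschitzWith.const x).weaken zero_le, rfl⟩
  obtain ⟨f, hf, hmin⟩ := LowerSemicontinuousOn.exists_isMinOn hne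
    (isCompact_setOf_lipschitzWith C x) hlsc
  exact ⟨f, hf, fun g hg => hmin (a := ⟨g, hg.1.continuous⟩) hg⟩

end LipschitzMinimizer

/-! ### Time changes that cap the speed, and a uniform Lipschitz bound. -/

section Reparametrization

variable {E : Type*} [NormedAddCommGroup E] [NormedSpace ℝ E] [FiniteDimensional ℝ E]

theorem exists_measurableSet_subset_ae_eq {α : Type*} [MeasurableSpace α] {μ : Measure α}
    {p : α → Prop} (hp : ∀ᵐ s ∂μ, p s) {A : Set α} (hA : MeasurableSet A) :
    ∃ S ⊆ A, MeasurableSet S ∧ S =ᵐ[μ] A ∧ ∀ s ∈ S, p s := by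
  refine ⟨A \ toMeasurable μ {s | ¬ p s}, sdiff_subset, hA.diff (measurableSet_toMeasurable _ _),
    sdiff_null_ae_eq_self ((measure_toMeasurable _).trans (ae_iff.mp hp)), fun s hs => ?_⟩
  by_contra h
  exact hs.2 (subset_toMeasurable _ _ h)

/-- A Lipschitz path `f` can be reparametrized by a time change with speed `a`, bounded above and
away from zero. -/
theorem exists_timeChange {a : ℝ → ℝ} {B : ℝ} {t : ℝ} (ht : 0 < t) (hm : Measurable a)
    (hlo : ∀ s, 1 / 2 ≤ a s) (hhi : ∀ s, a s ≤ B) (hint : ∫ s in (0 : ℝ)..t, a s = t)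
    {C L : ℝ≥0} {f : ℝ → E} (hf : LipschitzWith C f) (hL : ∀ s, ‖deriv f s‖ ≤ L * a s) :
    ∃ g : ℝ → E, LipschitzWith L g ∧ g 0 = f 0 ∧ g t = f t ∧ ∀ H : E → E → ℝ,
      ∫ s in (0 : ℝ)..t, H (g s) (deriv g s) =
        ∫ s in (0 : ℝ)..t, a s * H (f s) ((a s)⁻¹ • deriv f s) := by
  have ha0 (s : ℝ) : 0 < a s := lt_of_lt_of_le (by norm_num) (hlo s)
  have hloc : LocallyIntegrable a volume := by
    refine (locallyIntegrable_const B).mono hm.aestronglyMeasurable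
      (Eventually.of_forall fun s => ?_)
    rw [Real.norm_of_nonneg (ha0 s).le]
    exact (hhi s).trans (le_abs_self B)
  have hi (x y : ℝ) : IntervalIntegrable a volume x y :=
    intervalIntegrable_iff.mpr <|
      (hloc.integrableOn_isCompact isCompact_uIcc).mono_set uIoc_subset_uIcc
  -- The new path is `f ∘ σ⁻¹`. The lower bound on `a` makes `σ` a bijection of `ℝ`, and `σ t = t`
  -- preserves the horizon.
  set σ : ℝ → ℝ := fun s => ∫ r in (0 : ℝ)..s, a r with hσ
  have hσd (x y : ℝ) : σ y - σ x = ∫ r in x..y, a r :=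
    intervalIntegral.integral_interval_sub_left (hi _ _) (hi _ _)
  have hσ0 : σ 0 = 0 := intervalIntegral.integral_same
  have hσlo {x y : ℝ} (hxy : x ≤ y) : (y - x) / 2 ≤ σ y - σ x := by
    have : ∫ r in x..y, (1 / 2 : ℝ) ≤ ∫ r in x..y, a r :=
      intervalIntegral.integral_mono_on hxy (by simp) (hi _ _) fun s _ => hlo s
    rw [intervalIntegral.integral_const, smul_eq_mul] at this
    rw [hσd]
    linarith
  have hmono : StrictMono σ := fun x y hxy => by
    have := hσlo hxy.le
    linarith
  have hσc : Continuous σ := intervalIntegral.continuous_primitive hi 0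
  have hsurj : Function.Surjective σ := by
    refine hσc.surjective ?_ ?_
    · refine tendsto_atTop_mono' _ ?_ (tendsto_id.atTop_div_const (by norm_num : (0 : ℝ) < 2))
      filter_upwards [eventually_ge_atTop 0] with s hs
      have := hσlo hs
      simp only [id]
      linarith
    · refine tendsto_atBot_mono' _ ?_ (tendsto_id.atBot_div_const (by norm_num : (0 : ℝ) < 2))
      filter_upwards [eventually_le_atBot 0] with s hs
      have := hσlo hs
      simp only [id]
      linarith
  let e : ℝ ≃o ℝ := hmono.orderIsoOfSurjective σ hsurj
  have he (s : ℝ) : e.symm (σ s) = s := e.symm_apply_apply s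
  have he' (s : ℝ) : σ (e.symm s) = s := e.apply_symm_apply s
  have hkey {x y : ℝ} (hxy : x ≤ y) : dist (f x) (f y) ≤ L * dist (σ x) (σ y) := by
    rw [dist_comm, dist_comm (σ x), dist_eq_norm, ← integral_deriv_of_lipschitzWith hf hxy,
      Real.dist_eq, abs_of_nonneg (by linarith [hmono.monotone hxy]), hσd,
      ← intervalIntegral.integral_const_mul]
    exact intervalIntegral.norm_integral_le_of_norm_le hxy
      (Eventually.of_forall fun s _ => hL s) ((hi _ _).const_mul _)
  have hg : LipschitzWith L fun s => f (e.symm s) := LipschitzWith.of_dist_le_mul fun u v => by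
    rcases le_total (e.symm u) (e.symm v) with h | h
    · simpa only [he'] using hkey h
    · rw [dist_comm, dist_comm u]
      simpa only [he'] using hkey h
  have hσt : σ t = t := hint
  refine ⟨fun s => f (e.symm s), hg, ?_, ?_, fun H => ?_⟩
  · change f (e.symm 0) = f 0
    conv_lhs => rw [← hσ0, he]
  · change f (e.symm t) = f t
    conv_lhs => rw [← hσt, he]
  -- Change of variables is applied on a measurable set of full measure where both `σ` and `f` are
  -- differentiable at every point.
  obtain ⟨S, hSsub, hSm, hSae, hS⟩ := exists_measurableSet_subset_ae_eq
    ((LocallyIntegrable.ae_hasDerivAt_integral hloc).and hf.ae_differentiableAt_real)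
    (measurableSet_Ioo (a := 0) (b := t))
  have hcv (G : ℝ → ℝ) : ∫ y in σ '' S, G y = ∫ s in Ioo 0 t, a s * G (σ s) := by
    rw [integral_image_eq_integral_abs_deriv_smul hSm
      (fun s hs => ((hS s hs).1 0).hasDerivWithinAt) hmono.injective.injOn,
      setIntegral_congr_set hSae]
    simp only [abs_of_pos (ha0 _), smul_eq_mul, hσ]
  have himg : σ '' S ⊆ Ioo 0 t := by
    rintro _ ⟨s, hs, rfl⟩
    have := hSsub hs
    exact ⟨hσ0 ▸ hmono this.1, hσt ▸ hmono this.2⟩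
  have himm : MeasurableSet (σ '' S) :=
    hSm.image_of_continuousOn_injOn hσc.continuousOn hmono.injective.injOn
  -- The image has full measure, since its volume is the integral of `a` over `(0, t)`, which is
  -- `t`.
  have hae : σ '' S =ᵐ[volume] Ioo 0 t := by
    refine ae_eq_of_subset_of_measure_ge himg ?_ himm.nullMeasurableSet (by simp)
    have h1 := hcv fun _ => 1
    simp only [mul_one, integral_const, smul_eq_mul, measureReal_restrict_apply_univ] at h1
    rw [← integral_Ioc_eq_integral_Ioo, ← intervalIntegral.integral_of_le ht.le, hint] at h1
    rw [Real.volume_Ioo, sub_zero, ← h1,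
      ofReal_measureReal ((measure_mono himg).trans_lt (by simp)).ne]
  rw [intervalIntegral.integral_of_le ht.le, intervalIntegral.integral_of_le ht.le,
    integral_Ioc_eq_integral_Ioo, integral_Ioc_eq_integral_Ioo, ← setIntegral_congr_set hae,
    hcv, ← setIntegral_congr_set hSae, ← setIntegral_congr_set hSae]
  refine setIntegral_congr_fun hSm fun s hs => ?_
  have hd1 : HasDerivAt e.symm (a s)⁻¹ (σ s) := by
    refine HasDerivAt.of_local_left_inverse e.symm.continuous.continuousAt ?_ (ha0 s).ne'
      (Eventually.of_forall he')
    rw [he]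
    exact (hS s hs).1 0
  have hd2 : HasDerivAt (fun s => f (e.symm s)) ((a s)⁻¹ • deriv f s) (σ s) := by
    refine HasDerivAt.scomp (σ s) ?_ hd1
    rw [he]
    exact (hS s hs).2.hasDerivAt
  simp only [hd2.deriv, he]

/-- Pointwise estimate for the time change that caps the speed `√τ` at level `K`. -/
theorem capped_lagrangian_le {u u₀ u₁ τ κ K δ χ : ℝ} (hu₀ : u₀ ≤ u) (hu₁ : u ≤ u₁) (hτ : 0 ≤ τ)
    (hK : 0 < K) (hκ : κ ≤ K ^ 2) (hδ0 : 0 ≤ δ) (hδ : δ ≤ 1 / 2)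
    (hχ : (τ ≤ κ ∧ χ = 1) ∨ χ = 0) :
    (max 1 (√τ / K) - δ * χ) * (u + ((max 1 (√τ / K) - δ * χ)⁻¹) ^ 2 * τ) ≤
      u + τ + (max 1 (√τ / K) - 1) * (u₁ - K ^ 2) + δ * χ * (2 * κ - u₀) := by
  have hr0 := Real.sqrt_nonneg τ
  have hr2 := Real.sq_sqrt hτ
  set r := √τ with hr
  rcases le_or_gt r K with h | h
  · rw [max_eq_left ((div_le_one hK).mpr h)]
    -- Slow region: with `χ = 1`, the weight is `1 - δ ≥ 1/2`, so speeding up costs at most `δ (2κ -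
    -- u₀)`.
    rcases hχ with ⟨hτκ, rfl⟩ | rfl
    · have h1 : 0 < 1 - δ * 1 := by linarith
      have h2 : (1 - δ * 1) * (u + ((1 - δ * 1)⁻¹) ^ 2 * τ) =
          u + τ + δ * ((1 - δ * 1)⁻¹ * τ - u) := by
        have h0 (w : ℝ) (hw : w ≠ 0) :
            w * (u + (w⁻¹) ^ 2 * τ) = u + τ + (1 - w) * (w⁻¹ * τ - u) := by
          field_simp
          ring
        rw [h0 _ h1.ne']
        ring
      have h3 : (1 - δ * 1)⁻¹ ≤ 2 := by
        rw [inv_le_comm₀ h1 (by norm_num)]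
        linarith
      have h4 : (1 - δ * 1)⁻¹ * τ ≤ 2 * κ := mul_le_mul h3 hτκ hτ (by norm_num)
      have h5 := mul_le_mul_of_nonneg_left (a := δ) (by linarith : (1 - δ * 1)⁻¹ * τ - u ≤ 2 * κ - u₀) hδ0
      rw [h2]
      linarith
    · simp
  · rw [max_eq_right ((one_le_div hK).mpr h.le)]
    have hχ0 : χ = 0 := by
      rcases hχ with ⟨hτκ, -⟩ | h0
      · nlinarith
      · exact h0
    have hr' : 0 < r := hK.trans h
    -- Fast region: the speed `r` drops to `K` while the duration is stretched by `r / K`.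
    have h1 : r / K * (u + ((r / K)⁻¹) ^ 2 * τ) = u + τ + (r / K - 1) * (u - r * K) := by
      rw [← hr2]
      field_simp
      ring
    have h2 : 0 ≤ r / K - 1 := by
      rw [sub_nonneg, one_le_div hK]
      exact h.le
    have h3 : u - r * K ≤ u₁ - K ^ 2 := by nlinarith
    have h4 := mul_le_mul_of_nonneg_left h3 h2
    simp only [hχ0, mul_zero, sub_zero, zero_mul, add_zero]
    rw [h1]
    linarith

/-- Taken with `r = √T(f')` and integrated, this bounds the time lost by capping by the kinetic
energy over `K ^ 2`. -/
theorem max_one_div_sub_one_le {r K : ℝ} : max 1 (r / K) - 1 ≤ r ^ 2 / K ^ 2 := by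
  rw [← div_pow]
  rcases le_total (r / K) 1 with h | h
  · rw [max_eq_left h]
    nlinarith [sq_nonneg (r / K)]
  · rw [max_eq_right h]
    nlinarith [sq_nonneg (r / K)]

/-- Capping the speed of a Lipschitz path of bounded kinetic energy: the action does not increase,
and the Lipschitz constant of the new path depends only on the given bounds. -/
theorem exists_capped_path {U T : E → ℝ} (hU : Continuous U)
    (hT : Continuous T) {c : ℝ} (hc : 0 < c) (hcT : ∀ v, c * ‖v‖ ^ 2 ≤ T v)
    (hTh : ∀ (l : ℝ) v, T (l • v) = l ^ 2 * T v) (Φ : E → ℝ) {t u₀ u₁ Q K : ℝ} (ht : 0 < t)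
    (hQ : 0 < Q) (hK : 0 < K) (hK1 : 4 * Q / t ≤ K ^ 2) (hK2 : u₁ - u₀ + 4 * Q / t ≤ K ^ 2)
    {C : ℝ≥0} {f : ℝ → E} (hf : LipschitzWith C f) (hu₀ : ∀ x, u₀ ≤ U x)
    (hu₁ : ∀ s ∈ Icc 0 t, U (f s) ≤ u₁) (hE : ∫ s in (0 : ℝ)..t, T (deriv f s) ≤ Q) :
    ∃ g : ℝ → E, LipschitzWith (Real.toNNReal (2 * K / √c)) g ∧ g 0 = f 0 ∧
      bolza U T Φ t g ≤ bolza U T Φ t f := by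
  have hT0 (v : E) : 0 ≤ T v := (by positivity : 0 ≤ c * ‖v‖ ^ 2).trans (hcT v)
  have hTm := measurable_comp_deriv hT f
  have hTi := intervalIntegrable_comp_deriv hT hf
  obtain ⟨B, hB0, hB⟩ := exists_bound_comp_deriv hT C
  -- By Markov's inequality, `T(f') ≥ κ` on a set of measure at most `t / 2`, so the slow set `A`
  -- below has measure at least `t / 2`.
  set κ : ℝ := 2 * Q / t with hκ
  have hκ0 : 0 < κ := by positivity
  have h4κ : 4 * Q / t = 2 * κ := by rw [hκ]; ring
  rw [h4κ] at hK1 hK2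
  set ρ : ℝ → ℝ := fun s => max 1 (√(T (deriv f s)) / K) with hρ
  have hρm : Measurable ρ := measurable_const.max (hTm.sqrt.div_const K)
  have hρ1 (s : ℝ) : 1 ≤ ρ s := le_max_left _ _
  have hρB (s : ℝ) : ρ s ≤ max 1 (√B / K) := by
    refine max_le_max le_rfl ?_
    gcongr
    exact (abs_le.mp (hB f hf s)).2
  have hbi {b : ℝ → ℝ} {D : ℝ} (hb : Measurable b) (hbD : ∀ s, |b s| ≤ D) (x y : ℝ) :
      IntervalIntegrable b volume x y :=
    (intervalIntegrable_const (c := D)).mono_fun hb.aestronglyMeasurable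
      (Eventually.of_forall fun s => (hbD s).trans (le_abs_self D))
  have hρi := hbi hρm fun s => (abs_of_nonneg (zero_le_one.trans (hρ1 s))).trans_le (hρB s)
  set A : Set ℝ := Ioo 0 t ∩ {s | T (deriv f s) ≤ κ} with hA
  have hAm : MeasurableSet A := measurableSet_Ioo.inter (measurableSet_le hTm measurable_const)
  have hAv : t / 2 ≤ volume.real A := by
    have hmk := mul_meas_ge_le_integral_of_nonneg (μ := volume.restrict (Ioo 0 t))
      (f := fun s => T (deriv f s)) (Eventually.of_forall fun s => hT0 _)
      (integrableOn_comp_deriv hT hf (by simp)) κ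
    rw [← integral_Ioc_eq_integral_Ioo, ← intervalIntegral.integral_of_le ht.le,
      measureReal_restrict_apply (measurableSet_le measurable_const hTm)] at hmk
    have hcov : volume.real (Ioo 0 t) ≤
        volume.real A + volume.real ({s | κ ≤ T (deriv f s)} ∩ Ioo 0 t) := by
      refine (measureReal_mono (fun s hs => ?_) ?_).trans (measureReal_union_le _ _)
      · rcases le_total (T (deriv f s)) κ with h | h
        · exact Or.inl ⟨hs, h⟩
        · exact Or.inr ⟨h, hs⟩
      · refine ((measure_mono (union_subset inter_subset_left inter_subset_right)).trans_lt
          (?_ : volume (Ioo 0 t) < ⊤)).ne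
        simp
    rw [Real.volume_real_Ioo_of_le ht.le, sub_zero] at hcov
    have h2 : κ * volume.real ({s | κ ≤ T (deriv f s)} ∩ Ioo 0 t) ≤ κ * (t / 2) := by
      refine hmk.trans (hE.trans_eq ?_)
      rw [hκ]
      field_simp
    have := le_of_mul_le_mul_left h2 hκ0
    linarith
  have hA0 : 0 < volume.real A := by linarith
  set χ : ℝ → ℝ := A.indicator 1 with hχ
  have hχm : Measurable χ := measurable_one.indicator hAm
  have hχ01 (s : ℝ) : 0 ≤ χ s ∧ χ s ≤ 1 := by
    by_cases h : s ∈ A <;> simp [hχ, h]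
  have hχi := hbi hχm fun s => (abs_of_nonneg (hχ01 s).1).trans_le (hχ01 s).2
  have hχint : ∫ s in (0 : ℝ)..t, χ s = volume.real A := by
    rw [intervalIntegral.integral_of_le ht.le, integral_Ioc_eq_integral_Ioo,
      integral_indicator_one hAm, measureReal_restrict_apply hAm,
      inter_eq_left.mpr (inter_subset_left : A ⊆ Ioo 0 t)]
  set m : ℝ := ∫ s in (0 : ℝ)..t, (ρ s - 1) with hm
  have hm0 : 0 ≤ m := intervalIntegral.integral_nonneg ht.le fun s _ => by linarith [hρ1 s]
  have hmQ : m ≤ Q / K ^ 2 := by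
    have : m ≤ ∫ s in (0 : ℝ)..t, T (deriv f s) / K ^ 2 := by
      refine intervalIntegral.integral_mono_on ht.le ((hρi _ _).sub (by simp))
        ((hTi _ _).div_const _) fun s _ => ?_
      have := max_one_div_sub_one_le (r := √(T (deriv f s))) (K := K)
      rwa [Real.sq_sqrt (hT0 _)] at this
    rw [intervalIntegral.integral_div] at this
    exact this.trans (by gcongr)
  -- The time `m` gained by capping is removed evenly over `A`. As `m ≤ Q / K ^ 2 ≤ t / 4`, this
  -- gives `δ ≤ 1 / 2`.
  set δ : ℝ := m / volume.real A with hδ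
  have hδA : δ * volume.real A = m := div_mul_cancel₀ _ hA0.ne'
  have hδ0 : 0 ≤ δ := by positivity
  have hδ2 : δ ≤ 1 / 2 := by
    rw [hδ, div_le_iff₀ hA0]
    refine hmQ.trans ?_
    have h1 : Q / K ^ 2 ≤ t / 4 := by
      rw [div_le_iff₀ (by positivity)]
      have : κ * t = 2 * Q := by rw [hκ]; field_simp
      nlinarith
    linarith
  set a : ℝ → ℝ := fun s => ρ s - δ * χ s with ha
  have hδχ (s : ℝ) : 0 ≤ δ * χ s ∧ δ * χ s ≤ 1 / 2 :=
    ⟨mul_nonneg hδ0 (hχ01 s).1, (mul_le_of_le_one_right hδ0 (hχ01 s).2).trans hδ2⟩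
  have ham : Measurable a := hρm.sub (hχm.const_mul δ)
  have halo (s : ℝ) : 1 / 2 ≤ a s := by
    have h1 := (hδχ s).2
    have h2 := hρ1 s
    simp only [ha]
    linarith
  have hi1 : IntervalIntegrable (fun s => ρ s - 1) volume 0 t := (hρi _ _).sub (by simp)
  have hint : ∫ s in (0 : ℝ)..t, a s = t := by
    have : ∀ s, a s = (ρ s - 1) - δ * χ s + 1 := fun s => by simp only [ha]; ring
    simp only [this]
    rw [intervalIntegral.integral_add (hi1.sub ((hχi _ _).const_mul δ)) (by simp),
      intervalIntegral.integral_sub hi1 ((hχi _ _).const_mul δ),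
      intervalIntegral.integral_const_mul, hχint, hδA, ← hm]
    simp
  have hspeed (s : ℝ) : ‖deriv f s‖ ≤ Real.toNNReal (2 * K / √c) * a s := by
    have hsc : 0 < √c := Real.sqrt_pos.mpr hc
    rw [Real.coe_toNNReal _ (by positivity)]
    have h1 : √c * ‖deriv f s‖ ≤ √(T (deriv f s)) := by
      refine Real.le_sqrt_of_sq_le ?_
      rw [mul_pow, Real.sq_sqrt hc.le]
      exact hcT _
    have h2 : √(T (deriv f s)) ≤ K * ρ s := by
      rw [mul_comm, ← div_le_iff₀ hK]
      exact le_max_right _ _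
    have h3 : ρ s ≤ 2 * a s := by
      have h4 := (hδχ s).2
      have h5 := hρ1 s
      simp only [ha]
      linarith
    rw [div_mul_eq_mul_div, le_div_iff₀ hsc]
    nlinarith
  obtain ⟨g, hgL, hg0, hgt, hgH⟩ := exists_timeChange ht ham halo
    (fun s => (sub_le_self _ (hδχ s).1).trans (hρB s)) hint hf hspeed
  refine ⟨g, hgL, hg0, ?_⟩
  rw [bolza, bolza, hgt, hgH fun x v => U x + T v]
  refine add_le_add_left ?_ _
  have hLi : IntervalIntegrable (fun s => U (f s) + T (deriv f s)) volume 0 t :=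
    (Continuous.intervalIntegrable (u := fun s => U (f s)) (hU.comp hf.continuous) _ _).add
      (hTi _ _)
  have hRi : IntervalIntegrable (fun s => (ρ s - 1) * (u₁ - K ^ 2) + δ * χ s * (2 * κ - u₀))
      volume 0 t := (hi1.mul_const _).add (((hχi _ _).const_mul δ).mul_const _)
  have hint2 : ∫ s in (0 : ℝ)..t, ((U (f s) + T (deriv f s)) +
      ((ρ s - 1) * (u₁ - K ^ 2) + δ * χ s * (2 * κ - u₀))) ≤
      ∫ s in (0 : ℝ)..t, (U (f s) + T (deriv f s)) := by
    rw [intervalIntegral.integral_add hLi hRi, intervalIntegral.integral_add (hi1.mul_const _)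
      (((hχi _ _).const_mul δ).mul_const _), intervalIntegral.integral_mul_const,
      intervalIntegral.integral_mul_const, intervalIntegral.integral_const_mul, hχint, hδA, ← hm]
    -- Net balance of slowing down and speeding up; its sign is what `hK2` was imposed for.
    have : m * (u₁ - K ^ 2) + m * (2 * κ - u₀) ≤ 0 := by
      rw [← mul_add]
      exact mul_nonpos_of_nonneg_of_nonpos hm0 (by linarith)
    linarith
  have hpt (s : ℝ) (hs : s ∈ Icc 0 t) : a s * (U (f s) + T ((a s)⁻¹ • deriv f s)) ≤
      (U (f s) + T (deriv f s)) + ((ρ s - 1) * (u₁ - K ^ 2) + δ * χ s * (2 * κ - u₀)) := by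
    rw [hTh]
    refine (capped_lagrangian_le (κ := κ) (hu₀ (f s)) (hu₁ s hs) (hT0 _) hK (by linarith) hδ0 hδ2
      ?_).trans_eq (by simp only [hρ]; ring)
    by_cases h : s ∈ A
    · exact Or.inl ⟨h.2, by simp [hχ, h]⟩
    · exact Or.inr (by simp [hχ, h])
  refine le_trans ?_ hint2
  refine intervalIntegral.integral_mono_on ht.le ?_ (hLi.add hRi) hpt
  have h2 : (fun s => a s * (U (f s) + T ((a s)⁻¹ • deriv f s))) =
      fun s => a s * U (f s) + (a s)⁻¹ * T (deriv f s) := funext fun s => by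
    have : a s ≠ 0 := by linarith [halo s]
    rw [hTh]
    field_simp
  rw [h2]
  refine IntervalIntegrable.add ?_ ?_
  · exact ((hρi _ _).sub ((hχi _ _).const_mul δ)).mul_continuousOn
      (hU.comp hf.continuous).continuousOn
  · refine hbi (D := 2 * B) (ham.inv.mul hTm) (fun s => ?_) _ _
    have h3 := halo s
    have h4 : (a s)⁻¹ ≤ 2 := by
      rw [inv_le_comm₀ (by linarith) (by norm_num)]
      linarith
    change |(a s)⁻¹ * T (deriv f s)| ≤ 2 * B
    rw [abs_mul, abs_of_nonneg (by positivity : 0 ≤ (a s)⁻¹)]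
    exact mul_le_mul h4 (hB f hf s) (abs_nonneg _) (by norm_num)

/-- Lipschitz paths can be replaced by equi-Lipschitz ones without increasing the action. -/
theorem exists_lipschitz_bound_of_bolza {U T Φ : E → ℝ} (hU : Continuous U)
    (hUb : BddBelow (range U)) (hT : Continuous T) {c : ℝ} (hc : 0 < c)
    (hcT : ∀ v, c * ‖v‖ ^ 2 ≤ T v) (hTh : ∀ (l : ℝ) v, T (l • v) = l ^ 2 * T v)
    (hΦb : BddBelow (range Φ)) {t : ℝ} (ht : 0 < t) (x : E) :
    ∃ L : ℝ≥0, ∀ (C : ℝ≥0) (f : ℝ → E), LipschitzWith C f → f 0 = x →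
      ∃ g : ℝ → E, LipschitzWith L g ∧ g 0 = x ∧ bolza U T Φ t g ≤ bolza U T Φ t f := by
  have := FiniteDimensional.proper ℝ E
  obtain ⟨u₀, hu₀⟩ := hUb
  obtain ⟨p₀, hp₀⟩ := hΦb
  have hu₀' (y : E) : u₀ ≤ U y := hu₀ (mem_range_self y)
  have hT0 (v : E) : 0 ≤ T v := (by positivity : 0 ≤ c * ‖v‖ ^ 2).trans (hcT v)
  -- Kinetic energy bound for every path whose action does not exceed that of the constant path; any
  -- worse path is replaced by the constant one.
  set Q : ℝ := max 0 (bolza U T Φ t (fun _ => x) - t * u₀ - p₀) + 1 with hQ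
  have hQ0 : 0 < Q := by positivity
  -- The radius comes from `‖f'‖ ≤ 1 + ‖f'‖² ≤ 1 + T(f') / c`, integrated over `[0, t]`.
  obtain ⟨u₁, hu₁⟩ :=
    (isCompact_closedBall x (t + Q / c)).exists_bound_of_continuousOn hU.continuousOn
  set K : ℝ := √(4 * Q / t + |u₁ - u₀|) with hK
  have hK2 : K ^ 2 = 4 * Q / t + |u₁ - u₀| := Real.sq_sqrt (by positivity)
  have hK0 : 0 < K := Real.sqrt_pos.mpr (by positivity)
  refine ⟨Real.toNNReal (2 * K / √c), fun C f hf hfx => ?_⟩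
  rcases lt_or_ge (bolza U T Φ t fun _ => x) (bolza U T Φ t f) with hlt | hle
  · exact ⟨fun _ => x, (LipschitzWith.const x).weaken zero_le, rfl, hlt.le⟩
  have hTi := intervalIntegrable_comp_deriv hT hf
  have hE : ∫ s in (0 : ℝ)..t, T (deriv f s) ≤ Q := by
    rw [bolza_eq_add hU hT hf] at hle
    have h1 : ∫ s in (0 : ℝ)..t, u₀ ≤ ∫ s in (0 : ℝ)..t, U (f s) :=
      intervalIntegral.integral_mono_on ht.le (by simp)
        ((hU.comp hf.continuous).intervalIntegrable _ _) fun s _ => hu₀' _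
    rw [intervalIntegral.integral_const, sub_zero, smul_eq_mul] at h1
    have h2 : p₀ ≤ Φ (f t) := hp₀ (mem_range_self _)
    have h3 := le_max_right 0 (bolza U T Φ t (fun _ => x) - t * u₀ - p₀)
    linarith
  have hbd (s : ℝ) (hs : s ∈ Icc 0 t) : U (f s) ≤ u₁ := by
    refine (le_abs_self _).trans (hu₁ _ ?_)
    rw [Metric.mem_closedBall, dist_eq_norm, ← hfx, ← integral_deriv_of_lipschitzWith hf hs.1]
    have hpt (r : ℝ) : ‖deriv f r‖ ≤ 1 + T (deriv f r) / c := by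
      have h1 : ‖deriv f r‖ ^ 2 ≤ T (deriv f r) / c := by
        rw [le_div_iff₀ hc, mul_comm]
        exact hcT _
      nlinarith [sq_nonneg (‖deriv f r‖ - 1), sq_nonneg ‖deriv f r‖]
    have hi (x y : ℝ) : IntervalIntegrable (fun r => 1 + T (deriv f r) / c) volume x y :=
      (intervalIntegrable_const).add ((hTi _ _).div_const c)
    calc ‖∫ r in (0 : ℝ)..s, deriv f r‖ ≤ ∫ r in (0 : ℝ)..s, (1 + T (deriv f r) / c) :=
          intervalIntegral.norm_integral_le_of_norm_le hs.1
            (Eventually.of_forall fun r _ => hpt r) (hi _ _)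
      _ ≤ ∫ r in (0 : ℝ)..t, (1 + T (deriv f r) / c) :=
          intervalIntegral.integral_mono_interval le_rfl hs.1 hs.2
            (Eventually.of_forall fun r => (norm_nonneg _).trans (hpt r)) (hi _ _)
      _ = t + (∫ r in (0 : ℝ)..t, T (deriv f r)) / c := by
          rw [intervalIntegral.integral_add (by simp) ((hTi _ _).div_const c),
            intervalIntegral.integral_div]
          simp
      _ ≤ t + Q / c := by gcongr
  obtain ⟨g, hg, hg0, hgle⟩ := exists_capped_path hU hT hc hcT hTh Φ ht hQ0 hK0
    (u₀ := u₀) (u₁ := u₁)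
    (by rw [hK2]; linarith [abs_nonneg (u₁ - u₀)]) (by rw [hK2]; linarith [le_abs_self (u₁ - u₀)])
    hf hu₀' hbd hE
  exact ⟨g, hg, hg0.trans hfx, hgle⟩

/-- **Existence of Lipschitz minimizers** of the Bolza problem for the Lagrangian `U(x) + T(v)`. -/
theorem exists_lipschitz_minimizer_bolza {U T Φ : E → ℝ} (hU : Continuous U)
    (hUb : BddBelow (range U)) (hT : Continuous T) (hTc : ConvexOn ℝ univ T) {c : ℝ} (hc : 0 < c)
    (hcT : ∀ v, c * ‖v‖ ^ 2 ≤ T v) (hTh : ∀ (l : ℝ) v, T (l • v) = l ^ 2 * T v)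
    (hΦ : Continuous Φ) (hΦb : BddBelow (range Φ)) {t : ℝ} (ht : 0 < t) (x : E) :
    ∃ (L : ℝ≥0) (f : ℝ → E), LipschitzWith L f ∧ f 0 = x ∧
      ∀ (C : ℝ≥0) (g : ℝ → E), LipschitzWith C g → g 0 = x →
        bolza U T Φ t f ≤ bolza U T Φ t g := by
  obtain ⟨L, hL⟩ := exists_lipschitz_bound_of_bolza hU hUb hT hc hcT hTh hΦb ht x
  obtain ⟨f, ⟨hf, hfx⟩, hmin⟩ := exists_isMinOn_bolza_lipschitzWith hU hT hTc
    (fun v => (by positivity : 0 ≤ c * ‖v‖ ^ 2).trans (hcT v)) hΦ ht.le L x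
  refine ⟨L, f, hf, hfx, fun C g hg hgx => ?_⟩
  obtain ⟨g', hg', hgx', hle⟩ := hL C g hg hgx
  exact (hmin (a := g') ⟨hg', hgx'⟩).trans hle

end Reparametrization

/-! ### Coercivity and convexity of the kinetic form. -/

section Kinetic

theorem exists_pos_mul_sq_norm_le {E : Type*} [NormedAddCommGroup E] [NormedSpace ℝ E]
    [FiniteDimensional ℝ E] {T : E → ℝ} (hT : Continuous T)
    (hTh : ∀ (l : ℝ) v, T (l • v) = l ^ 2 * T v) (hpos : ∀ v, v ≠ 0 → 0 < T v) :
    ∃ c : ℝ, 0 < c ∧ ∀ v, c * ‖v‖ ^ 2 ≤ T v := by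
  have := FiniteDimensional.proper ℝ E
  have hT0 : T 0 = 0 := by simpa using hTh 0 0
  -- The sphere is empty when `E` is trivial, as for `N = 0` or `d = 0`; otherwise `c` is the
  -- minimum of `T` on it.
  rcases (Metric.sphere (0 : E) 1).eq_empty_or_nonempty with he | hne
  · refine ⟨1, one_pos, fun v => ?_⟩
    have hv : v = 0 := by
      by_contra hv
      have : ‖v‖⁻¹ • v ∈ Metric.sphere (0 : E) 1 := by
        rw [mem_sphere_zero_iff_norm, norm_smul, norm_inv, norm_norm,
          inv_mul_cancel₀ (norm_ne_zero_iff.mpr hv)]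
      simp [he] at this
    simp [hv, hT0]
  · obtain ⟨w, hw, hmin⟩ := (isCompact_sphere (0 : E) 1).exists_isMinOn hne hT.continuousOn
    rw [mem_sphere_zero_iff_norm] at hw
    refine ⟨T w, hpos w (norm_ne_zero_iff.mp (by simp [hw])), fun v => ?_⟩
    rcases eq_or_ne v 0 with rfl | hv
    · simp [hT0]
    · have hv' : ‖v‖ ≠ 0 := norm_ne_zero_iff.mpr hv
      have h1 : T w ≤ T (‖v‖⁻¹ • v) := hmin (a := ‖v‖⁻¹ • v) (by
        rw [mem_sphere_zero_iff_norm, norm_smul, norm_inv, norm_norm, inv_mul_cancel₀ hv'])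
      rw [hTh] at h1
      calc T w * ‖v‖ ^ 2 ≤ (‖v‖⁻¹) ^ 2 * T v * ‖v‖ ^ 2 := by gcongr
        _ = T v := by field_simp

variable {d : ℕ} {M : Matrix (Fin d) (Fin d) ℝ}

theorem continuous_kinetic (M : Matrix (Fin d) (Fin d) ℝ) : Continuous (kinetic M) := by
  unfold kinetic
  simp only [dotProduct, Matrix.mulVec]
  fun_prop

theorem kinetic_smul (M : Matrix (Fin d) (Fin d) ℝ) (l : ℝ) (v : EuclideanSpace ℝ (Fin d)) :
    kinetic M (l • v) = l ^ 2 * kinetic M v := by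
  simp only [kinetic, WithLp.ofLp_smul, Matrix.mulVec_smul, smul_dotProduct, dotProduct_smul,
    smul_eq_mul]
  ring

theorem kinetic_pos (hM : M.PosDef) {v : EuclideanSpace ℝ (Fin d)} (hv : v ≠ 0) :
    0 < kinetic M v := by
  have h := hM.dotProduct_mulVec_pos (x := v.ofLp) (by simpa using hv)
  rw [star_trivial] at h
  exact mul_pos (by norm_num) h

theorem kinetic_nonneg (hM : M.PosDef) (v : EuclideanSpace ℝ (Fin d)) : 0 ≤ kinetic M v := by
  rcases eq_or_ne v 0 with rfl | hv
  · simp [kinetic]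
  · exact (kinetic_pos hM hv).le

theorem convexOn_kinetic (hM : M.PosDef) : ConvexOn ℝ univ (kinetic M) := by
  refine ⟨convex_univ, fun u _ v _ a b _ hb hab => ?_⟩
  have ha : a = 1 - b := by linarith
  -- The convexity defect of a quadratic form is again the form, evaluated at `u - v`.
  have key : a • kinetic M u + b • kinetic M v - kinetic M (a • u + b • v) =
      a * b * kinetic M (u - v) := by
    simp only [kinetic, WithLp.ofLp_smul, WithLp.ofLp_add, WithLp.ofLp_sub, Matrix.mulVec_smul,
      Matrix.mulVec_add, Matrix.mulVec_sub, smul_dotProduct, dotProduct_smul, add_dotProduct,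
      dotProduct_add, sub_dotProduct, dotProduct_sub, smul_eq_mul]
    rw [ha]
    ring
  have := mul_nonneg (mul_nonneg ‹0 ≤ a› hb) (kinetic_nonneg hM (u - v))
  linarith

end Kinetic

/-! ### The `N`-particle action as a Bolza functional. -/

section Action

variable {N d : ℕ}

/-- The total kinetic term `∑ᵢ ½ vᵢᵀ Mᵢ vᵢ`. -/
noncomputable def totalKinetic (M : Fin N → Matrix (Fin d) (Fin d) ℝ) (v : Config N d) : ℝ :=
  ∑ i, kinetic (M i) (v i)

theorem continuous_totalKinetic (M : Fin N → Matrix (Fin d) (Fin d) ℝ) :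
    Continuous (totalKinetic M) :=
  continuous_finsetSum _ fun i _ => (continuous_kinetic (M i)).comp (continuous_apply i)

theorem totalKinetic_smul (M : Fin N → Matrix (Fin d) (Fin d) ℝ) (l : ℝ) (v : Config N d) :
    totalKinetic M (l • v) = l ^ 2 * totalKinetic M v := by
  simp only [totalKinetic, Pi.smul_apply, kinetic_smul, Finset.mul_sum]

theorem totalKinetic_pos {M : Fin N → Matrix (Fin d) (Fin d) ℝ} (hM : ∀ i, (M i).PosDef)
    {v : Config N d} (hv : v ≠ 0) : 0 < totalKinetic M v := by
  obtain ⟨i, hi⟩ := Function.ne_iff.mp hv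
  exact Finset.sum_pos' (fun i _ => kinetic_nonneg (hM i) _)
    ⟨i, Finset.mem_univ i, kinetic_pos (hM i) hi⟩

theorem convexOn_totalKinetic {M : Fin N → Matrix (Fin d) (Fin d) ℝ} (hM : ∀ i, (M i).PosDef) :
    ConvexOn ℝ univ (totalKinetic M) := by
  refine ⟨convex_univ, fun u _ v _ a b ha hb hab => ?_⟩
  simp only [totalKinetic, Finset.smul_sum, ← Finset.sum_add_distrib]
  exact Finset.sum_le_sum fun i _ =>
    (convexOn_kinetic (hM i)).2 (mem_univ (u i)) (mem_univ (v i)) ha hb hab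

theorem continuous_totalPotential {V : Fin N → EuclideanSpace ℝ (Fin d) → ℝ} {W : Config N d → ℝ}
    (hV : ∀ i, Continuous (V i)) (hW : Continuous W) : Continuous (totalPotential V W) :=
  (continuous_finsetSum _ fun i _ => (hV i).comp (continuous_apply i)).add hW

theorem bddBelow_range_totalPotential {V : Fin N → EuclideanSpace ℝ (Fin d) → ℝ}
    {W : Config N d → ℝ} (hV : ∀ i, BddBelow (range (V i))) (hW : BddBelow (range W)) :
    BddBelow (range (totalPotential V W)) := by
  choose b hb using hV
  obtain ⟨w, hw⟩ := hW
  refine ⟨∑ i, b i + w, ?_⟩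
  rintro _ ⟨x, rfl⟩
  exact add_le_add (Finset.sum_le_sum fun i _ => hb i (mem_range_self _)) (hw (mem_range_self x))

/-- Bridge from Sobolev to Lipschitz paths: the running cost sees the derivative only up to null
sets of `(0, t)`, so the choice made in `weakDeriv` is immaterial. -/
theorem action_eq_bolza (M : Fin N → Matrix (Fin d) (Fin d) ℝ)
    (V : Fin N → EuclideanSpace ℝ (Fin d) → ℝ) (W Φ : Config N d → ℝ) {t : ℝ} (ht : 0 < t)
    {ξ f : ℝ → Config N d} (hξ : EqOn ξ f (Icc 0 t))
    (hd : weakDeriv t ξ =ᵐ[volume.restrict (Ioo 0 t)] deriv f) :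
    action M V W Φ t ξ = bolza (totalPotential V W) (totalKinetic M) Φ t f := by
  unfold action bolza
  rw [hξ ⟨ht.le, le_rfl⟩, intervalIntegral.integral_of_le ht.le,
    intervalIntegral.integral_of_le ht.le, integral_Ioc_eq_integral_Ioo,
    integral_Ioc_eq_integral_Ioo]
  congr 1
  refine integral_congr_ae ?_
  filter_upwards [hd, ae_restrict_mem measurableSet_Ioo] with s hs hmem
  rw [hs, hξ (Ioo_subset_Icc_self hmem), totalPotential, totalKinetic, Finset.sum_add_distrib]
  ring

end Action

end NBody

theorem mainTheorem8 (N d : ℕ) (M : Fin N → Matrix (Fin d) (Fin d) ℝ)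
    (V : Fin N → EuclideanSpace ℝ (Fin d) → ℝ) (W : NBody.Config N d → ℝ)
    (Φ : ℝ → NBody.Config N d → ℝ)
    (hM : ∀ i, (M i).PosDef)
    (hVc : ∀ i, Continuous (V i)) (hVb : ∀ i, BddBelow (Set.range (V i)))
    (hWc : Continuous W) (hWb : BddBelow (Set.range W))
    (hcoer : Filter.Tendsto (NBody.totalPotential V W)
      (Filter.cocompact (NBody.Config N d)) Filter.atTop)
    (x : NBody.Config N d) (t : ℝ) (ht : 0 < t)
    (hΦc : Continuous (Φ t)) (hΦb : BddBelow (Set.range (Φ t))) :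
    ∃ ξ ∈ NBody.admissiblePaths t x,
      IsMinOn (NBody.action M V W (Φ t) t) (NBody.admissiblePaths t x) ξ := by
  obtain ⟨c, hc, hcT⟩ := NBody.exists_pos_mul_sq_norm_le (NBody.continuous_totalKinetic M)
    (NBody.totalKinetic_smul M) fun v hv => NBody.totalKinetic_pos hM hv
  obtain ⟨L, f, hf, hfx, hmin⟩ := NBody.exists_lipschitz_minimizer_bolza
    (NBody.continuous_totalPotential hVc hWc) (NBody.bddBelow_range_totalPotential hVb hWb)
    (NBody.continuous_totalKinetic M) (NBody.convexOn_totalKinetic hM) hc hcT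
    (NBody.totalKinetic_smul M) hΦc hΦb ht x
  have hfm := NBody.memW1Inf_of_lipschitzWith hf ht.le
  refine ⟨f, ⟨hfm, hfx⟩, fun ξ hξ => ?_⟩
  -- The constant `C` depends on the competitor, which is why `hmin` compares `f` with paths of
  -- every Lipschitz constant.
  obtain ⟨C, g, hg, hξg, hd⟩ := hξ.1.exists_lipschitzWith ht
  change NBody.action M V W (Φ t) t f ≤ NBody.action M V W (Φ t) t ξ
  rw [NBody.action_eq_bolza M V W (Φ t) ht (fun s _ => rfl)
      (NBody.weakDeriv_ae_eq hfm (NBody.isBoundedWeakDeriv_of_lipschitzWith hf ht.le)),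
    NBody.action_eq_bolza M V W (Φ t) ht hξg hd]
  exact hmin C g hg ((hξg ⟨le_rfl, ht.le⟩).symm.trans hξ.2)
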